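/- Let $\kappa$ be a regular uncountable cardinal. A $\kappa$-Souslin tree is a (strict) poset $\mathbf T=(T,<_T)$ with $|T|=\kappa$, with no chains and no antichains of size $\kappa$, such that $x_\downarrow=\{y\in T : y<_T x\}$ is well-ordered by $<_T$ for every $x\in T$; write $\mathrm{ht}(x)$ for the order type of $x_\downarrow$. The tree is $\chi$-splitting if every $x\in T$ has at least $\chi$ many immediate successors ($y>_T x$ with $\mathrm{ht}(y)=\mathrm{ht}(x)+1$), and ordinal-based if $T=\kappa$ and $\mathrm{ht}(x)<\mathrm{ht}(y)$ implies $x\in y$ for all $x,y\in T$. An $\alpha$-branch is a chain $B\subseteq T$ with $\{\mathrm{ht}(x): x\in B\}=\alpha$; it is vanishing if it has no upper bound in $T$. Let $V(\mathbf T)$ be the set of all nonzero limit ordinals $\alpha<\kappa$ such that every $x\in T$ with $\mathrm{ht}(x)<\alpha$ belongs to a vanishing $\alpha$-branch. Let $E^\kappa_\chi=\{\alpha<\kappa : \mathrm{cf}(\alpha)=\chi\}$. For $S\subseteq\kappa$, a sequence $\langle\mathcal A_\alpha : \alpha\in S\rangle$ is an AD-multi-ladder system if (i) for every nonzero limit ordinal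 $\alpha\in S$, $\mathcal A_\alpha$ is a nonempty family of pairwise disjoint cofinal subsets of $\alpha$; and (ii) $\sup(A\cap A')<\sup(A)$ for any two distinct $A,A'\in\bigcup_{\alpha\in S}\mathcal A_\alpha$. **Theorem.** Let $\mathbf T$ be an ordinal-based $\chi$-splitting $\kappa$-Souslin tree, and let $\theta\le\chi$ be a cardinal satisfying $\kappa^{<\theta}=\kappa$. Then for every collection $\mathcal S$ of pairwise disjoint stationary subsets of $V(\mathbf T)\cap E^\kappa_\chi$ there exists an AD-multi-ladder system $\langle\mathcal A_\alpha : \alpha\in E^\kappa_\chi\rangle$ such that for every family $\mathcal B$ of subsets of $\kappa$, each of size $\kappa$, with $|\mathcal B|<\theta$, every $S\in\mathcal S$, and every cardinal $\mu<\kappa$, the set $$\{\alpha\in S : |\mathcal A_\alpha|\ge\mu \text{ and } \sup(A\cap B)=\alpha \text{ for all } A\in\mathcal A_\alpha,\ B\in\mathcal B\}$$ is stationary in $\kappa$. -/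

import Mathlib

universe u

open Cardinal Ordinal Set Order

/-- A `κ`-Souslin tree with underlying set `T`: a strict partial order `lt` on a set of size `κ`,
with no chains and no antichains of size `κ`, in which the predecessors of every node are
well-ordered. -/
structure SouslinTree (κ : Cardinal.{u}) (T : Type u) where
  lt : T → T → Prop
  isStrictOrder : IsStrictOrder T lt
  mk_eq : #T = κ
  chain_ne : ∀ C : Set T, IsChain lt C → #C ≠ κ
  antichain_ne : ∀ A : Set T, IsAntichain lt A → #A ≠ κ
  isWellOrder_pred : ∀ x : T, IsWellOrder {y // lt y x} (Subrel lt (fun y => lt y x))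

namespace SouslinTree

variable {κ : Cardinal.{u}} {T : Type u}

/-- The height of a node: the order type of the set of its predecessors. -/
noncomputable def height (𝒯 : SouslinTree κ T) (x : T) : Ordinal.{u} :=
  haveI := 𝒯.isWellOrder_pred x
  Ordinal.type (Subrel 𝒯.lt (fun y => 𝒯.lt y x))

/-- Every node has at least `μ` many immediate successors. -/
def IsSplitting (𝒯 : SouslinTree κ T) (μ : Cardinal.{u}) : Prop :=
  ∀ x : T, μ ≤ #{y : T // 𝒯.lt x y ∧ 𝒯.height y = 𝒯.height x + 1}

/-- The underlying set is (the well-ordered set) `κ`, and nodes of smaller height are smaller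
ordinals. -/
def IsOrdinalBased (𝒯 : SouslinTree κ κ.ord.ToType) : Prop :=
  ∀ x y : κ.ord.ToType, 𝒯.height x < 𝒯.height y → x < y

/-- `B` is an `α`-branch: a chain meeting exactly the levels below `α`. -/
def IsBranch (𝒯 : SouslinTree κ T) (α : Ordinal.{u}) (B : Set T) : Prop :=
  IsChain 𝒯.lt B ∧ 𝒯.height '' B = Iio α

/-- `B` has no upper bound in the tree. -/
def IsVanishing (𝒯 : SouslinTree κ T) (B : Set T) : Prop :=
  ¬ ∃ z : T, ∀ x ∈ B, x = z ∨ 𝒯.lt x z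

/-- The levels of vanishing branches `V(𝒯)`: the nonzero limit ordinals `α < κ` such that every
node of height below `α` belongs to a vanishing `α`-branch. -/
def vanishingLevels (𝒯 : SouslinTree κ T) : Set κ.ord.ToType :=
  {α | IsSuccLimit (α : Ordinal.{u}) ∧
    ∀ x : T, 𝒯.height x < (α : Ordinal.{u}) →
      ∃ B : Set T, 𝒯.IsBranch (α : Ordinal.{u}) B ∧ 𝒯.IsVanishing B ∧ x ∈ B}

end SouslinTree

/-- `E^κ_χ`, the set of ordinals below `κ` of cofinality `χ`. -/
def cofSet (κ χ : Cardinal.{u}) : Set κ.ord.ToType :=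
  {α | (α : Ordinal.{u}).cof = χ}

/-- The supremum, as an ordinal, of a set of ordinals below `κ` (which is bounded by `κ`; the
supremum of the empty set is `0`). -/
noncomputable def ordSup {κ : Cardinal.{u}} (A : Set κ.ord.ToType) : Ordinal.{u} :=
  sSup ((fun β : κ.ord.ToType => (β : Ordinal.{u})) '' A)

/-- `A` is a cofinal subset of the ordinal `α < κ`. -/
def IsCofinalSubset {κ : Cardinal.{u}} (A : Set κ.ord.ToType) (α : κ.ord.ToType) : Prop :=
  (∀ β ∈ A, β < α) ∧ ∀ β < α, ∃ γ ∈ A, β ≤ γ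

/-- `⟨𝒜 α ∣ α ∈ S⟩` is an AD-multi-ladder system; only the values `𝒜 α` for `α ∈ S` matter. -/
structure IsADMultiLadderSystem {κ : Cardinal.{u}} (S : Set κ.ord.ToType)
    (𝒜 : κ.ord.ToType → Set (Set κ.ord.ToType)) : Prop where
  nonempty : ∀ α ∈ S, IsSuccLimit (α : Ordinal.{u}) → (𝒜 α).Nonempty
  cofinal : ∀ α ∈ S, IsSuccLimit (α : Ordinal.{u}) → ∀ A ∈ 𝒜 α, IsCofinalSubset A α
  disjoint : ∀ α ∈ S, IsSuccLimit (α : Ordinal.{u}) →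
    ∀ A ∈ 𝒜 α, ∀ A' ∈ 𝒜 α, A ≠ A' → Disjoint A A'
  almost_disjoint : ∀ A ∈ ⋃ α ∈ S, 𝒜 α, ∀ A' ∈ ⋃ α ∈ S, 𝒜 α, A ≠ A' →
    ordSup (A ∩ A') < ordSup A

/-- `G_{≥μ}(S, ℬ)`: the `α ∈ S` such that `𝒜 α` has at least `μ` elements, each of which meets
every `B ∈ ℬ` cofinally in `α`. -/
def guessSet {κ : Cardinal.{u}} (𝒜 : κ.ord.ToType → Set (Set κ.ord.ToType)) (μ : Cardinal.{u})
    (S : Set κ.ord.ToType) (ℬ : Set (Set κ.ord.ToType)) : Set κ.ord.ToType :=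
  {α | α ∈ S ∧ μ ≤ #(𝒜 α) ∧ ∀ A ∈ 𝒜 α, ∀ B ∈ ℬ, ordSup (A ∩ B) = (α : Ordinal.{u})}

/-! The ladders at a limit `a` of cofinality `χ` come in two kinds: antichains of the tree with
initial segments smaller than `χ`, and unions of tails of fewer than `χ` vanishing `a`-branches.
Almost disjointness rests on three facts. A chain meets an antichain in at most one point, so
ladders of different kinds share fewer than `χ = cf(a)` points. An antichain ladder has fewer than
`χ` points below any smaller level. A vanishing branch shares only a bounded part with any longer
branch, and fewer than `χ` such bounds have a bound below `a`.

Guessing comes from the Souslin property. A set `B` of size `κ` is dense above some node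
(`exists_denseAbove`), and then for club many `a` every `a`-branch through that node meets `B`
cofinally (`DenseAbove.exists_isClub`). For fewer than `θ` sets, such nodes are lifted to one common
level. Above each lifted node, pairwise incompatible nodes `q i` are chosen, and the `i`-th ladder
runs along vanishing branches through the `i`-th nodes. This gives as many disjoint ladders as
desired, each meeting every `B` cofinally.

Such a choice is coded by a set of fewer than `θ` nodes and an ordinal below `κ`; since `κ ^< θ =
κ`, there are at most `κ` codes (`IsNormal.exists_nodeFamilies`). Each `S` is partitioned into
stationary pieces, one for each code (`exists_forall_isStationary_fiber`), and the ladders at `a`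
follow the code of its piece. At all remaining limits of cofinality `χ` a single antichain ladder is
used. -/

/-! ### Clubs and stationary sets in a well-order -/

section WellOrder

variable {K : Type u} [LinearOrder K]

theorem exists_forall_lt_of_mk_lt_cof {s : Set K} (hs : #s < Order.cof K) :
    ∃ b, ∀ x ∈ s, x < b := by
  have h : ¬ IsCofinal s := fun h => (cof_le h).not_gt hs
  simpa [IsCofinal] using h

theorem exists_lt_forall_lt_of_mk_lt_cof_Iio {a : K} {s : Set K} (hsa : ∀ x ∈ s, x < a)
    (hs : #s < Order.cof (Iio a)) : ∃ b < a, ∀ x ∈ s, x < b := by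
  obtain ⟨b, hb⟩ := exists_forall_lt_of_mk_lt_cof (K := Iio a) (s := Subtype.val ⁻¹' s)
    ((mk_preimage_of_injective _ _ Subtype.val_injective).trans_lt hs)
  exact ⟨b, b.2, fun x hx => hb ⟨x, hsa x hx⟩ hx⟩

theorem isClub_Ioi [NoMaxOrder K] (c : K) : IsClub (Ioi c) :=
  ⟨(isUpperSet_Ioi c).dirSupClosed, fun a =>
    let ⟨b, hb⟩ := exists_gt (max a c)
    ⟨b, (le_max_right _ _).trans_lt hb, ((le_max_left _ _).trans_lt hb).le⟩⟩

variable [WellFoundedLT K]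

/-- For unboundedness, iterate a map `h` with `g b < h x` for all `b ≤ x`. Uncountable cofinality
bounds the `ω` iterates, and their least strict upper bound is closed under `g`. -/
theorem isClub_closurePoints (hcof : ℵ₀ < Order.cof K)
    (hseg : ∀ a : K, #(Iic a) < Order.cof K) (g : K → K) :
    IsClub {a | ∀ b < a, g b < a} := by
  have : Nonempty K := by
    by_contra h
    rw [not_nonempty_iff] at h
    simp at hcof
  constructor
  · intro d hd _ _ a ha b hb
    obtain ⟨c, hc, hbc⟩ := (lt_isLUB_iff ha).1 hb
    exact (hd hc b hbc).trans_le (ha.1 hc)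
  · intro a
    have hex : ∀ x : K, ∃ y, x < y ∧ ∀ b ≤ x, g b < y := by
      intro x
      obtain ⟨y, hy⟩ := exists_forall_lt_of_mk_lt_cof (s := insert x (g '' Iic x)) (by
        refine (mk_insert_le).trans_lt (add_lt_of_lt hcof.le (mk_image_le.trans_lt (hseg x)) ?_)
        exact one_lt_aleph0.trans hcof)
      exact ⟨y, hy x (mem_insert _ _),
        fun b hb => hy _ (mem_insert_of_mem _ (mem_image_of_mem g hb))⟩
    choose h hlt hh using hex
    obtain ⟨u, hu⟩ := exists_forall_lt_of_mk_lt_cof (s := range fun n : ℕ => h^[n] a) (by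
      refine lt_of_le_of_lt ?_ hcof
      simpa using mk_range_le_lift (f := fun n : ℕ => h^[n] a))
    let U : Set K := {u | ∀ n : ℕ, h^[n] a < u}
    have hU : U.Nonempty := ⟨u, fun n => hu _ ⟨n, rfl⟩⟩
    obtain ⟨m, hm, hmin⟩ := WellFounded.has_min (wellFounded_lt (α := K)) U hU
    refine ⟨m, fun b hb => ?_, (hm 0).le⟩
    have : ¬ ∀ n : ℕ, h^[n] a < b := fun hb' => hmin b hb' hb
    push Not at this
    obtain ⟨n, hn⟩ := this
    have := hm (n + 1)
    rw [Function.iterate_succ_apply'] at this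
    exact (hh _ b hn).trans this

theorem IsStationary.inter_isClub (hcof : ℵ₀ < Order.cof K) {S C : Set K} (hS : IsStationary S)
    (hC : IsClub C) : IsStationary (S ∩ C) := by
  intro t ht
  rw [inter_assoc]
  exact hS (hC.inter hcof.ne' ht)

/-- **Fodor's lemma**: a regressive function on a stationary set has a stationary fiber. -/
theorem IsStationary.exists_isStationary_fiber (hcof : ℵ₀ < Order.cof K)
    (hseg : ∀ a : K, #(Iic a) < Order.cof K) {S : Set K} (hS : IsStationary S) {f : K → K}
    (hf : ∀ a ∈ S, f a < a) : ∃ c, IsStationary {a ∈ S | f a = c} := by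
  by_contra! h
  simp only [not_isStationary_iff] at h
  choose C hC hdisj using h
  have hgt : ∀ x : K, ∃ y, x < y := fun x => by
    obtain ⟨y, hy⟩ := exists_forall_lt_of_mk_lt_cof (s := {x}) (by
      simpa using one_lt_aleph0.trans hcof)
    exact ⟨y, hy x rfl⟩
  have hnext : ∀ c x : K, ∃ y ∈ C c, x < y := fun c x => by
    obtain ⟨y, hy⟩ := hgt x
    obtain ⟨z, hz, hyz⟩ := (hC c).isCofinal y
    exact ⟨z, hz, hy.trans_le hyz⟩
  choose next hnextC hnext using hnext
  have hbd : ∀ x, ∃ y, ∀ c ≤ x, next c x < y := fun x => by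
    obtain ⟨y, hy⟩ := exists_forall_lt_of_mk_lt_cof (s := (next · x) '' Iic x)
      (mk_image_le.trans_lt (hseg x))
    exact ⟨y, fun c hc => hy _ (mem_image_of_mem (next · x) hc)⟩
  choose g hg using hbd
  -- This is the diagonal intersection argument: a point `a` closed under `g` is a limit of `C (f
  -- a)`, because `next (f a) x < g x < a` whenever `f a ≤ x < a`.
  obtain ⟨a, haS, ha⟩ := hS (isClub_closurePoints hcof hseg g)
  have hfa := hf a haS
  have key : a ∈ C (f a) := by
    refine (hC (f a)).isLUB_mem (t := C (f a) ∩ Iio a) inter_subset_left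
      ⟨next (f a) (f a), hnextC _ _, (hg _ _ le_rfl).trans (ha _ hfa)⟩ ⟨fun x hx => hx.2.le, ?_⟩
    intro b hb
    by_contra! hba
    have hx : max b (f a) < a := max_lt hba hfa
    have h1 := hb ⟨hnextC (f a) (max b (f a)), (hg _ _ (le_max_right _ _)).trans (ha _ hx)⟩
    exact absurd ((le_max_left b (f a)).trans_lt (hnext (f a) _)) h1.not_gt
  exact disjoint_left.1 (hdisj (f a)) ⟨haS, rfl⟩ key

/-- A stationary set of points of bounded cofinality splits into `#K` many stationary sets,
provided that `K` is regular. -/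
theorem IsStationary.exists_forall_isStationary_fiber (hcof : ℵ₀ < Order.cof K)
    (hseg : ∀ a : K, #(Iic a) < Order.cof K) (hK : Order.cof K = #K) {I : Type u}
    (hI : #I < Order.cof K) {S : Set K} (hS : IsStationary S) (lad : K → I → K)
    (hlt : ∀ a ∈ S, ∀ i, lad a i < a) (hlad : ∀ a ∈ S, ∀ b < a, ∃ i, b ≤ lad a i)
    {P : Type u} [Nonempty P] (hP : #P ≤ #K) :
    ∃ f : K → P, ∀ p, IsStationary {a ∈ S | f a = p} := by
  have hgt : NoMaxOrder K := ⟨fun x => by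
    obtain ⟨y, hy⟩ := exists_forall_lt_of_mk_lt_cof (s := {x}) (by
      simpa using one_lt_aleph0.trans hcof)
    exact ⟨y, hy x rfl⟩⟩
  -- Otherwise each coordinate `i` has a bound `e i` exceeded only on a nonstationary set. With `u`
  -- above all `e i`, the points of `S` beyond `u` would be covered by fewer than `cof K`
  -- nonstationary sets.
  obtain ⟨i, hi⟩ : ∃ i, ∀ e, IsStationary {a ∈ S | e ≤ lad a i} := by
    by_contra! h
    choose e he using h
    obtain ⟨u, hu⟩ := exists_forall_lt_of_mk_lt_cof (s := range e) (mk_range_le.trans_lt hI)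
    have h1 : IsStationary (⋃ i, {a ∈ S | e i ≤ lad a i}) := by
      refine (hS.inter_isClub hcof (isClub_Ioi u)).mono fun a ha => ?_
      obtain ⟨i, hi⟩ := hlad a ha.1 u ha.2
      exact mem_iUnion.2 ⟨i, ha.1, (hu _ ⟨i, rfl⟩).le.trans hi⟩
    obtain ⟨i, hi⟩ := (isStationary_iUnion_iff hcof.ne' (by simpa using hI)).1 h1
    exact he i hi
  let W : Set K := {c | IsStationary {a ∈ S | lad a i = c}}
  have hW : IsCofinal W := fun e => by
    obtain ⟨c, hc⟩ := (hi e).exists_isStationary_fiber hcof hseg (f := (lad · i))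
      fun a ha => hlt a ha.1 i
    refine ⟨c, hc.mono fun a ha => ⟨ha.1.1, ha.2⟩, ?_⟩
    obtain ⟨a, ha⟩ := hc.nonempty
    exact ha.1.2.trans_eq ha.2
  have hPW : #P ≤ #W := hP.trans (hK ▸ cof_le hW)
  obtain ⟨emb⟩ := Cardinal.le_def _ _ |>.1 hPW
  -- Values not of the form `emb p` are sent anywhere; this can only enlarge the fibers.
  refine ⟨fun a => Function.invFun (fun p => (emb p : K)) (lad a i), fun p => ?_⟩
  refine IsStationary.mono (emb p).2 fun a ha => ⟨ha.1, ?_⟩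
  change Function.invFun _ (lad a i) = p
  rw [ha.2]
  exact Function.leftInverse_invFun (f := fun p => (emb p : K))
    (Subtype.val_injective.comp emb.injective) p

end WellOrder

/-! ### Heights, minimal nodes and branches in a Souslin tree -/

namespace SouslinTree

section Basic

variable {κ : Cardinal.{u}} {T : Type u} (𝒯 : SouslinTree κ T) {x y z : T}

/-- The reflexive closure of the tree order. -/
def le (x y : T) : Prop := x = y ∨ 𝒯.lt x y

theorem lt_trans (hxy : 𝒯.lt x y) (hyz : 𝒯.lt y z) : 𝒯.lt x z :=
  𝒯.isStrictOrder.trans _ _ _ hxy hyz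

theorem le_refl (x : T) : 𝒯.le x x := Or.inl rfl

variable {𝒯}

theorem le.trans (hxy : 𝒯.le x y) (hyz : 𝒯.le y z) : 𝒯.le x z := by
  rcases hxy with rfl | hxy
  · exact hyz
  · rcases hyz with rfl | hyz
    · exact Or.inr hxy
    · exact Or.inr (𝒯.lt_trans hxy hyz)

theorem le.trans_lt (hxy : 𝒯.le x y) (hyz : 𝒯.lt y z) : 𝒯.lt x z := by
  rcases hxy with rfl | hxy
  · exact hyz
  · exact 𝒯.lt_trans hxy hyz

variable (𝒯)

theorem height_eq_typein (h : 𝒯.lt x y) :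
    haveI := 𝒯.isWellOrder_pred y
    𝒯.height x = typein (Subrel 𝒯.lt (fun z => 𝒯.lt z y)) ⟨x, h⟩ := by
  have := 𝒯.isWellOrder_pred y
  have := 𝒯.isWellOrder_pred x
  unfold height
  change _ = type _
  refine type_eq.2 ⟨⟨⟨fun z => ⟨⟨z.1, 𝒯.lt_trans z.2 h⟩, z.2⟩, fun z => ⟨z.1.1, z.2⟩,
    fun z => rfl, fun z => rfl⟩, ?_⟩⟩
  intro a b
  rfl

theorem height_lt_height (h : 𝒯.lt x y) : 𝒯.height x < 𝒯.height y := by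
  have := 𝒯.isWellOrder_pred y
  rw [𝒯.height_eq_typein h]
  exact typein_lt_type _ _

variable {𝒯} in
theorem le.height_le (h : 𝒯.le x y) : 𝒯.height x ≤ 𝒯.height y := by
  rcases h with rfl | h
  · exact le_rfl
  · exact (𝒯.height_lt_height h).le

theorem exists_lt_height_eq {o : Ordinal.{u}} (h : o < 𝒯.height y) :
    ∃ x, 𝒯.lt x y ∧ 𝒯.height x = o := by
  have := 𝒯.isWellOrder_pred y
  obtain ⟨⟨x, hx⟩, rfl⟩ := typein_surj (Subrel 𝒯.lt (fun z => 𝒯.lt z y)) h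
  exact ⟨x, hx, 𝒯.height_eq_typein hx⟩

theorem eq_of_lt_of_lt (hx : 𝒯.lt x z) (hy : 𝒯.lt y z) (h : 𝒯.height x = 𝒯.height y) :
    x = y := by
  have := 𝒯.isWellOrder_pred z
  rw [𝒯.height_eq_typein hx, 𝒯.height_eq_typein hy, typein_inj] at h
  exact congrArg Subtype.val h

variable {𝒯}

theorem le.eq_of_height_le (h : 𝒯.le x y) (hh : 𝒯.height y ≤ 𝒯.height x) : x = y :=
  h.resolve_right fun h' => (𝒯.height_lt_height h').not_ge hh

/-- Two nodes below a common node are comparable, in the order of their heights. -/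
theorem le.le_of_height_le (hx : 𝒯.le x z) (hy : 𝒯.le y z) (h : 𝒯.height x ≤ 𝒯.height y) :
    𝒯.le x y := by
  rcases hy with rfl | hy
  · exact hx
  rcases hx with rfl | hx
  · exact absurd h (𝒯.height_lt_height hy).not_ge
  rcases h.eq_or_lt with h | h
  · exact Or.inl (𝒯.eq_of_lt_of_lt hx hy h)
  · obtain ⟨w, hw, hwx⟩ := 𝒯.exists_lt_height_eq h
    rw [← 𝒯.eq_of_lt_of_lt (𝒯.lt_trans hw hy) hx hwx]
    exact Or.inr hw

theorem le.eq_of_height_eq (hx : 𝒯.le x z) (hy : 𝒯.le y z) (h : 𝒯.height x = 𝒯.height y) :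
    x = y :=
  (hx.le_of_height_le hy h.le).eq_of_height_le h.ge

variable (𝒯)

theorem not_lt_of_height_le (h : 𝒯.height y ≤ 𝒯.height x) : ¬ 𝒯.lt x y :=
  fun h' => (𝒯.height_lt_height h').not_ge h

theorem wellFounded_lt : WellFounded 𝒯.lt :=
  Subrelation.wf (fun h => 𝒯.height_lt_height h) (InvImage.wf 𝒯.height Ordinal.lt_wf)

/-- The minimal nodes of a set of nodes. -/
def minimals (X : Set T) : Set T := {z ∈ X | ∀ w ∈ X, ¬ 𝒯.lt w z}

theorem isAntichain_minimals (X : Set T) : IsAntichain 𝒯.lt (𝒯.minimals X) :=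
  fun _ hx _ hy _ h => hy.2 _ hx.1 h

theorem exists_minimals_le {X : Set T} (hx : x ∈ X) : ∃ m ∈ 𝒯.minimals X, 𝒯.le m x := by
  obtain ⟨m, ⟨hm, hmx⟩, hmin⟩ := 𝒯.wellFounded_lt.has_min {m | m ∈ X ∧ 𝒯.le m x}
    ⟨x, hx, 𝒯.le_refl x⟩
  exact ⟨m, ⟨hm, fun w hw hwm => hmin w ⟨hw, le.trans (Or.inr hwm) hmx⟩ hwm⟩,
    hmx⟩

theorem mk_lt_of_isAntichain {A : Set T} (hA : IsAntichain 𝒯.lt A) : #A < κ :=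
  ((mk_set_le A).trans_eq 𝒯.mk_eq).lt_of_ne (𝒯.antichain_ne A hA)

/-- Every extension of `x` is extended by an element of `B`. -/
def DenseAbove (B : Set T) (x : T) : Prop := ∀ y, 𝒯.le x y → ∃ z ∈ B, 𝒯.le y z

variable {𝒯}

theorem DenseAbove.mono {B : Set T} (h : 𝒯.DenseAbove B x) (hxy : 𝒯.le x y) :
    𝒯.DenseAbove B y :=
  fun z hz => h z (hxy.trans hz)

/-- A node below `y` that is at least two-splitting has an immediate successor which is not
below `y`. -/
theorem IsSplitting.exists_succ_not_le {χ : Cardinal.{u}} (h : 𝒯.IsSplitting χ) (hχ : ℵ₀ ≤ χ)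
    (x y : T) : ∃ q, 𝒯.lt x q ∧ 𝒯.height q = 𝒯.height x + 1 ∧ ¬ 𝒯.le q y := by
  have h1 : 1 < #{y : T // 𝒯.lt x y ∧ 𝒯.height y = 𝒯.height x + 1} :=
    (one_lt_aleph0.trans_le hχ).trans_le (h x)
  obtain ⟨⟨q, hq⟩, ⟨r, hr⟩, hqr⟩ := (one_lt_iff_nontrivial.1 h1).exists_pair_ne
  by_cases hqy : 𝒯.le q y
  · refine ⟨r, hr.1, hr.2, fun hry => hqr (Subtype.ext ?_)⟩
    exact hqy.eq_of_height_eq hry (hq.2.trans hr.2.symm)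
  · exact ⟨q, hq.1, hq.2, hqy⟩

section Branch

variable {α : Ordinal.{u}} {b : Set T}

theorem IsBranch.height_lt (hb : 𝒯.IsBranch α b) (hx : x ∈ b) : 𝒯.height x < α := by
  have : 𝒯.height x ∈ 𝒯.height '' b := ⟨x, hx, rfl⟩
  rwa [hb.2] at this

theorem IsBranch.exists_height_eq (hb : 𝒯.IsBranch α b) {o : Ordinal.{u}} (ho : o < α) :
    ∃ x ∈ b, 𝒯.height x = o := by
  have : o ∈ 𝒯.height '' b := hb.2 ▸ ho
  exact this

theorem IsBranch.le_of_height_le (hb : 𝒯.IsBranch α b) (hx : x ∈ b) (hy : y ∈ b)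
    (h : 𝒯.height x ≤ 𝒯.height y) : 𝒯.le x y := by
  by_cases hxy : x = y
  · exact Or.inl hxy
  · exact Or.inr ((hb.1 hx hy hxy).resolve_right (𝒯.not_lt_of_height_le h))

theorem IsBranch.mem_of_le (hb : 𝒯.IsBranch α b) (hy : y ∈ b) (h : 𝒯.le x y) : x ∈ b := by
  obtain ⟨z, hz, hzx⟩ := hb.exists_height_eq (h.height_le.trans_lt (hb.height_lt hy))
  have := (hb.le_of_height_le hz hy (hzx.trans_le h.height_le)).eq_of_height_eq h hzx
  rwa [← this]

/-- A vanishing branch is not an initial segment of a longer branch. -/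
theorem IsBranch.exists_inter_height_lt (hb : 𝒯.IsBranch α b)
    (hv : 𝒯.IsVanishing b) {α' : Ordinal.{u}} {b' : Set T} (hb' : 𝒯.IsBranch α' b')
    (h : α < α') : ∃ o < α, ∀ x ∈ b ∩ b', 𝒯.height x < o := by
  by_contra! hcon
  obtain ⟨z, hz, hzα⟩ := hb'.exists_height_eq h
  -- If the intersection is unbounded in `b`, then `b ⊆ b'`, and the node of `b'` at height `α`
  -- bounds `b`.
  refine hv ⟨z, fun x hx => ?_⟩
  obtain ⟨w, hw, hxw⟩ := hcon _ (hb.height_lt hx)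
  have hxw' := hb.le_of_height_le hx hw.1 hxw
  exact hb'.le_of_height_le (hb'.mem_of_le hw.2 hxw') hz ((hb.height_lt hx).le.trans_eq hzα.symm)

end Branch

end Basic

end SouslinTree

/-! ### Cofinal subsets and suprema below `κ` -/

section ToType

variable {κ : Cardinal.{u}}

theorem toOrd_lt_toOrd {a b : κ.ord.ToType} : (a : Ordinal.{u}) < (b : Ordinal.{u}) ↔ a < b :=
  (ToType.mk (o := κ.ord)).symm.lt_iff_lt

theorem toOrd_le_toOrd {a b : κ.ord.ToType} : (a : Ordinal.{u}) ≤ (b : Ordinal.{u}) ↔ a ≤ b :=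
  (ToType.mk (o := κ.ord)).symm.le_iff_le

theorem toOrd_lt_ord (a : κ.ord.ToType) : (a : Ordinal.{u}) < κ.ord := a.toOrd.2

theorem exists_toOrd_eq {o : Ordinal.{u}} (h : o < κ.ord) :
    ∃ a : κ.ord.ToType, (a : Ordinal.{u}) = o :=
  ⟨ToType.mk ⟨o, h⟩, by simp⟩

theorem cof_Iio_toType (a : κ.ord.ToType) : Order.cof (Iio a) = (a : Ordinal.{u}).cof :=
  Order.cof_Iio a

theorem mk_Iio_toType (a : κ.ord.ToType) : #(Iio a) = (a : Ordinal.{u}).card := by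
  rfl

theorem mk_Iio_toType_lt (a : κ.ord.ToType) : #(Iio a) < κ := by
  rw [mk_Iio_toType]
  exact lt_ord.1 (toOrd_lt_ord a)

theorem mk_Iic_toType_lt (hκ : ℵ₀ ≤ κ) (a : κ.ord.ToType) : #(Iic a) < κ := by
  rw [← Iio_insert]
  exact mk_insert_le.trans_lt (add_lt_of_lt hκ (mk_Iio_toType_lt a)
    (one_lt_aleph0.trans_le hκ))

theorem exists_gt_of_isSuccLimit {a b : κ.ord.ToType} (ha : IsSuccLimit (a : Ordinal.{u}))
    (hb : b < a) : ∃ c, b < c ∧ c < a := by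
  obtain ⟨c, hc⟩ := exists_toOrd_eq ((ha.succ_lt (toOrd_lt_toOrd.2 hb)).trans (toOrd_lt_ord a))
  refine ⟨c, toOrd_lt_toOrd.1 (hc ▸ lt_succ _), toOrd_lt_toOrd.1 (hc ▸ ha.succ_lt ?_)⟩
  exact toOrd_lt_toOrd.2 hb

theorem bddAbove_image_toOrd (A : Set κ.ord.ToType) :
    BddAbove ((fun β : κ.ord.ToType => (β : Ordinal.{u})) '' A) :=
  ⟨κ.ord, by rintro _ ⟨b, _, rfl⟩; exact (toOrd_lt_ord b).le⟩

theorem ordSup_le {A : Set κ.ord.ToType} {o : Ordinal.{u}}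
    (h : ∀ b ∈ A, (b : Ordinal.{u}) ≤ o) : ordSup A ≤ o := by
  refine csSup_le' ?_
  rintro _ ⟨b, hb, rfl⟩
  exact h b hb

theorem IsCofinalSubset.ordSup_eq {A : Set κ.ord.ToType} {a : κ.ord.ToType}
    (ha : IsSuccLimit (a : Ordinal.{u})) (hA : IsCofinalSubset A a) :
    ordSup A = (a : Ordinal.{u}) := by
  refine le_antisymm (ordSup_le fun b hb => (toOrd_lt_toOrd.2 (hA.1 b hb)).le) ?_
  by_contra! hlt
  obtain ⟨b, hb⟩ := exists_toOrd_eq (hlt.trans (toOrd_lt_ord a))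
  have hba : b < a := toOrd_lt_toOrd.1 (hb ▸ hlt)
  obtain ⟨c, hbc, hca⟩ := exists_gt_of_isSuccLimit ha hba
  obtain ⟨d, hd, hcd⟩ := hA.2 c hca
  have h1 : (d : Ordinal.{u}) ≤ ordSup A := le_csSup (bddAbove_image_toOrd A) ⟨d, hd, rfl⟩
  rw [← hb, toOrd_le_toOrd] at h1
  exact (hbc.trans_le hcd).not_ge h1

theorem ordSup_inter_lt {A A' : Set κ.ord.ToType} {a : κ.ord.ToType}
    (ha : IsSuccLimit (a : Ordinal.{u})) (hA : IsCofinalSubset A a)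
    (h : ∃ c < a, ∀ x ∈ A ∩ A', x < c) : ordSup (A ∩ A') < ordSup A := by
  obtain ⟨c, hca, hc⟩ := h
  rw [hA.ordSup_eq ha]
  exact (ordSup_le fun b hb => (toOrd_lt_toOrd.2 (hc b hb)).le).trans_lt (toOrd_lt_toOrd.2 hca)

/-- Every point has a cofinal subset whose proper initial segments are smaller than its
cofinality. -/
theorem exists_isCofinalSubset_mk_lt (a : κ.ord.ToType) :
    ∃ C : Set κ.ord.ToType, IsCofinalSubset C a ∧
      ∀ d < a, #(C ∩ Iio d : Set κ.ord.ToType) < (a : Ordinal.{u}).cof := by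
  obtain ⟨s, hs, hst⟩ := exists_ord_cof_eq (Iio a)
  refine ⟨Subtype.val '' s, ⟨?_, ?_⟩, ?_⟩
  · rintro _ ⟨x, _, rfl⟩
    exact x.2
  · intro b hb
    obtain ⟨c, hc, hbc⟩ := hs ⟨b, hb⟩
    exact ⟨c, ⟨c, hc, rfl⟩, hbc⟩
  · intro d hd
    obtain ⟨e, he, hde⟩ := hs ⟨d, hd⟩
    have h1 : (typein (α := s) (· < ·) ⟨e, he⟩).card < Order.cof (Iio a) := by
      rw [← lt_ord, ← hst]
      exact typein_lt_type _ _
    rw [cof_Iio_toType] at h1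
    refine lt_of_le_of_lt ?_ h1
    refine mk_le_of_injective (f := fun x : (Subtype.val '' s ∩ Iio d : Set κ.ord.ToType) =>
      (⟨⟨⟨x.1, ?_⟩, ?_⟩, ?_⟩ : {z : s // z < ⟨e, he⟩})) ?_
    · obtain ⟨y, _, hy⟩ := x.2.1
      exact hy ▸ y.2
    · obtain ⟨y, hys, hy⟩ := x.2.1
      rwa [show (⟨x.1, _⟩ : Iio a) = y from Subtype.ext hy.symm]
    · exact (show (x : κ.ord.ToType) < d from x.2.2).trans_le hde
    · intro x y hxy
      simpa [Subtype.ext_iff] using hxy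

end ToType

/-! ### Ordinal-based trees -/

namespace SouslinTree

variable {κ : Cardinal.{u}} {𝒯 : SouslinTree κ κ.ord.ToType}

namespace IsOrdinalBased

variable {x y : κ.ord.ToType}

theorem height_mono (hbased : 𝒯.IsOrdinalBased) (h : x ≤ y) : 𝒯.height x ≤ 𝒯.height y :=
  not_lt.1 fun h' => (hbased _ _ h').not_ge h

theorem le_of_le (hbased : 𝒯.IsOrdinalBased) (h : 𝒯.le x y) : x ≤ y := by
  rcases h with rfl | h
  · exact le_rfl
  · exact (hbased _ _ (𝒯.height_lt_height h)).le

theorem height_lt_ord (hbased : 𝒯.IsOrdinalBased) (x : κ.ord.ToType) : 𝒯.height x < κ.ord := by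
  have := 𝒯.isWellOrder_pred x
  rw [lt_ord, height, card_type]
  refine lt_of_le_of_lt (mk_subtype_mono (q := fun y => y < x) ?_) (mk_Iio_toType_lt x)
  exact fun y hy => hbased _ _ (𝒯.height_lt_height hy)

end IsOrdinalBased

end SouslinTree

/-! ### Antichain ladders, branch ladders and their almost disjointness -/

namespace SouslinTree

variable {κ χ : Cardinal.{u}} {𝒯 : SouslinTree κ κ.ord.ToType}

variable (𝒯 χ) in
/-- A cofinal subset of `a` that is an antichain of the tree and has small initial segments. -/
structure IsAntichainLadder (a : κ.ord.ToType) (A : Set κ.ord.ToType) : Prop where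
  cofinal : IsCofinalSubset A a
  antichain : IsAntichain 𝒯.lt A
  mk_lt : ∀ d < a, #(A ∩ Iio d : Set κ.ord.ToType) < χ

variable (𝒯 χ) in
/-- A cofinal subset of `a` that is covered by few vanishing branches. -/
structure IsBranchLadder (a : κ.ord.ToType) (A : Set κ.ord.ToType) : Prop where
  cofinal : IsCofinalSubset A a
  height_lt_iff : ∀ z, 𝒯.height z < (a : Ordinal.{u}) ↔ z < a
  exists_cover : ∃ 𝓑 : Set (Set κ.ord.ToType), #𝓑 < χ ∧
    (∀ b ∈ 𝓑, 𝒯.IsBranch (a : Ordinal.{u}) b ∧ 𝒯.IsVanishing b) ∧ A ⊆ ⋃₀ 𝓑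

/-- If heights are eventually constant below `a`, a tail of any cofinal set is an antichain.
Otherwise `a` itself, as a node, lies above all the relevant levels, and the ladder is a comb:
immediate successors `q c` that leave the path below `a` at the height of `c`, for `c` in a thin
cofinal set `C`. -/
theorem exists_isAntichainLadder (hbased : 𝒯.IsOrdinalBased) (hsplit : 𝒯.IsSplitting χ)
    {a : κ.ord.ToType} (ha : IsSuccLimit (a : Ordinal.{u})) (hcof : (a : Ordinal.{u}).cof = χ) :
    ∃ A, 𝒯.IsAntichainLadder χ a A := by
  have hχ : ℵ₀ ≤ χ := hcof ▸ (isRegular_cof ha).aleph0_le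
  obtain ⟨C, hC, hCmk⟩ := exists_isCofinalSubset_mk_lt a
  rw [hcof] at hCmk
  by_cases h : ∃ z < a, ∀ w < a, z ≤ w → 𝒯.height w = 𝒯.height z
  · obtain ⟨z, hza, hz⟩ := h
    refine ⟨C ∩ Ici z, ⟨fun b hb => hC.1 b hb.1, fun b hb => ?_⟩, ?_, fun d hd => ?_⟩
    · obtain ⟨c, hc, hbc⟩ := hC.2 (max b z) (max_lt hb hza)
      exact ⟨c, ⟨hc, (le_max_right _ _).trans hbc⟩, (le_max_left _ _).trans hbc⟩
    · intro x hx y hy _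
      refine 𝒯.not_lt_of_height_le (le_of_eq ?_)
      rw [hz x (hC.1 x hx.1) hx.2, hz y (hC.1 y hy.1) hy.2]
    · exact (mk_le_mk_of_subset (inter_subset_inter_left _ inter_subset_left)).trans_lt (hCmk d hd)
  · push Not at h
    have hup : ∀ z < a, ∃ w < a, 𝒯.height z < 𝒯.height w := fun z hz => by
      obtain ⟨w, hwa, hzw, hne⟩ := h z hz
      exact ⟨w, hwa, (hbased.height_mono hzw).lt_of_ne hne.symm⟩
    have hq : ∀ c, c < a → ∃ q p, 𝒯.lt p a ∧ 𝒯.lt p q ∧ 𝒯.height p = 𝒯.height c ∧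
        𝒯.height q = 𝒯.height c + 1 ∧ ¬ 𝒯.le q a ∧ q < a ∧ c < q := fun c hc => by
      -- Two increases in height are needed: `q` has height at most that of `c₁`, hence lies below
      -- `c₂ < a` as an ordinal.
      obtain ⟨c₁, hc₁, h₁⟩ := hup c hc
      obtain ⟨c₂, hc₂, h₂⟩ := hup c₁ hc₁
      obtain ⟨p, hpa, hpc⟩ := 𝒯.exists_lt_height_eq (h₁.trans_le (hbased.height_mono hc₁.le))
      obtain ⟨q, hpq, hqp, hqa⟩ := hsplit.exists_succ_not_le hχ p a
      rw [hpc] at hqp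
      refine ⟨q, p, hpa, hpq, hpc, hqp, hqa, (hbased q c₂ ?_).trans hc₂, hbased c q ?_⟩
      · rw [hqp]
        exact (add_one_le_of_lt h₁).trans_lt h₂
      · rw [hqp]
        exact lt_add_one _
    have : Nonempty κ.ord.ToType := ⟨a⟩
    choose! q p hpa hpq hp hqh hqa hqlt hltq using hq
    refine ⟨q '' C, ⟨?_, ?_⟩, ?_, fun d hd => ?_⟩
    · rintro _ ⟨c, hc, rfl⟩
      exact hqlt c (hC.1 c hc)
    · intro b hb
      obtain ⟨c, hc, hbc⟩ := hC.2 b hb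
      exact ⟨q c, ⟨c, hc, rfl⟩, hbc.trans (hltq c (hC.1 c hc)).le⟩
    · rintro _ ⟨c, hc, rfl⟩ _ ⟨d, hd, rfl⟩ _ hlt
      replace hc := hC.1 c hc
      replace hd := hC.1 d hd
      have h1 := 𝒯.height_lt_height hlt
      rw [hqh c hc, hqh d hd] at h1
      have h2 : 𝒯.height c < 𝒯.height d := by simpa using h1
      -- If `q c` were below `q d`, it would be at or below `p d`, which lies on the path to `a`.
      have h3 : 𝒯.le (q c) (p d) := le.le_of_height_le (Or.inr hlt) (Or.inr (hpq d hd)) (by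
        rw [hqh c hc, hp d hd]
        exact add_one_le_of_lt h2)
      exact hqa c hc (Or.inr (h3.trans_lt (hpa d hd)))
    · refine lt_of_le_of_lt ?_ (hCmk d hd)
      refine (mk_le_mk_of_subset ?_).trans (mk_image_le (f := q))
      rintro _ ⟨⟨c, hc, rfl⟩, hcd⟩
      exact ⟨c, ⟨hc, (hltq c (hC.1 c hc)).trans hcd⟩, rfl⟩

theorem exists_lt_of_mk_inter_lt {a : κ.ord.ToType} (hcof : (a : Ordinal.{u}).cof = χ)
    {A A' : Set κ.ord.ToType} (hA : IsCofinalSubset A a)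
    (h : #(A ∩ A' : Set κ.ord.ToType) < χ) : ∃ c < a, ∀ x ∈ A ∩ A', x < c :=
  exists_lt_forall_lt_of_mk_lt_cof_Iio (fun x hx => hA.1 x hx.1)
    (by rwa [cof_Iio_toType, hcof])

/-- Each covering branch contains at most one point of the antichain, so the intersection injects
into the cover. -/
theorem IsAntichainLadder.mk_inter_lt_of_isBranchLadder {a a' : κ.ord.ToType}
    {A A' : Set κ.ord.ToType} (hA : 𝒯.IsAntichainLadder χ a A) (hA' : 𝒯.IsBranchLadder χ a' A') :
    #(A ∩ A' : Set κ.ord.ToType) < χ := by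
  obtain ⟨𝓑, hmk, h𝓑, hsub⟩ := hA'.exists_cover
  refine lt_of_le_of_lt ?_ hmk
  have hex : ∀ x : (A ∩ A' : Set κ.ord.ToType), ∃ b : 𝓑, x.1 ∈ b.1 := fun x => by
    obtain ⟨b, hb, hxb⟩ := hsub x.2.2
    exact ⟨⟨b, hb⟩, hxb⟩
  choose f hf using hex
  refine mk_le_of_injective (f := f) fun x y hxy => ?_
  by_contra hne
  have hne' : x.1 ≠ y.1 := fun h => hne (Subtype.ext h)
  rcases (h𝓑 (f x) (f x).2).1.1 (hf x) (hxy ▸ hf y) hne' with h | h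
  · exact hA.antichain x.2.1 y.2.1 hne' h
  · exact hA.antichain y.2.1 x.2.1 hne'.symm h

theorem IsAntichainLadder.mk_inter_lt {a a' : κ.ord.ToType} (h : a < a')
    {A A' : Set κ.ord.ToType} (hA : 𝒯.IsAntichainLadder χ a A)
    (hA' : 𝒯.IsAntichainLadder χ a' A') : #(A ∩ A' : Set κ.ord.ToType) < χ :=
  (mk_le_mk_of_subset (t := A' ∩ Iio a) fun x hx => ⟨hx.2, hA.cofinal.1 x hx.1⟩).trans_lt (hA'.mk_lt a h)

/-- Each pair of covering branches has bounded intersection because the shorter branch vanishes.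
There are fewer than `χ = cf(a)` pairs. -/
theorem IsBranchLadder.exists_inter_lt (hbased : 𝒯.IsOrdinalBased) {a a' : κ.ord.ToType}
    (ha : IsSuccLimit (a : Ordinal.{u})) (hcof : (a : Ordinal.{u}).cof = χ) (h : a < a')
    {A A' : Set κ.ord.ToType} (hA : 𝒯.IsBranchLadder χ a A) (hA' : 𝒯.IsBranchLadder χ a' A') :
    ∃ c < a, ∀ x ∈ A ∩ A', x < c := by
  have hχ : ℵ₀ ≤ χ := hcof ▸ (isRegular_cof ha).aleph0_le
  obtain ⟨𝓑, hmk, h𝓑, hsub⟩ := hA.exists_cover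
  obtain ⟨𝓑', hmk', h𝓑', hsub'⟩ := hA'.exists_cover
  have hex : ∀ i : 𝓑 × 𝓑', ∃ c < a, ∀ x ∈ i.1.1 ∩ i.2.1, x < c := by
    rintro ⟨⟨b, hb⟩, ⟨b', hb'⟩⟩
    obtain ⟨o, ho, hbd⟩ := (h𝓑 b hb).1.exists_inter_height_lt (h𝓑 b hb).2 (h𝓑' b' hb').1
      (toOrd_lt_toOrd.2 h)
    obtain ⟨y, hy, hyo⟩ := (h𝓑 b hb).1.exists_height_eq ho
    exact ⟨y, (hA.height_lt_iff y).1 ((h𝓑 b hb).1.height_lt hy),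
      fun x hx => hbased _ _ (hyo ▸ hbd x hx)⟩
  choose f hfa hf using hex
  obtain ⟨c, hca, hc⟩ := exists_lt_forall_lt_of_mk_lt_cof_Iio (a := a) (s := range f)
    (by rintro _ ⟨i, rfl⟩; exact hfa i) (by
      rw [cof_Iio_toType, hcof]
      refine mk_range_le.trans_lt ?_
      rw [mk_prod, Cardinal.lift_id, Cardinal.lift_id]
      exact mul_lt_of_lt hχ hmk hmk')
  refine ⟨c, hca, fun x hx => ?_⟩
  obtain ⟨b, hb, hxb⟩ := hsub hx.1
  obtain ⟨b', hb', hxb'⟩ := hsub' hx.2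
  exact (hf (⟨b, hb⟩, ⟨b', hb'⟩) x ⟨hxb, hxb'⟩).trans (hc _ ⟨_, rfl⟩)

/-- A system of pairwise disjoint antichain or branch ladders is almost disjoint. -/
theorem isADMultiLadderSystem (hbased : 𝒯.IsOrdinalBased)
    {𝒜 : κ.ord.ToType → Set (Set κ.ord.ToType)}
    (hempty : ∀ a : κ.ord.ToType, ¬ IsSuccLimit (a : Ordinal.{u}) → 𝒜 a = ∅)
    (hne : ∀ a ∈ cofSet κ χ, IsSuccLimit (a : Ordinal.{u}) → (𝒜 a).Nonempty)
    (hdisj : ∀ a ∈ cofSet κ χ, IsSuccLimit (a : Ordinal.{u}) → (𝒜 a).PairwiseDisjoint id)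
    (hlad : ∀ a ∈ cofSet κ χ, IsSuccLimit (a : Ordinal.{u}) → ∀ A ∈ 𝒜 a,
      𝒯.IsAntichainLadder χ a A ∨ 𝒯.IsBranchLadder χ a A) :
    IsADMultiLadderSystem (cofSet κ χ) 𝒜 := by
  have hcof : ∀ a ∈ cofSet κ χ, IsSuccLimit (a : Ordinal.{u}) → ∀ A ∈ 𝒜 a,
      IsCofinalSubset A a := fun a ha hl A hA => by
    rcases hlad a ha hl A hA with h | h <;> exact h.cofinal
  refine ⟨hne, hcof, fun a ha hl A hA A' hA' h => hdisj a ha hl hA hA' h, ?_⟩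
  intro A hA A' hA' hAA'
  simp only [mem_iUnion] at hA hA'
  obtain ⟨a, ha, hA⟩ := hA
  obtain ⟨a', ha', hA'⟩ := hA'
  have hl : IsSuccLimit (a : Ordinal.{u}) := by
    by_contra h
    simp [hempty a h] at hA
  have hl' : IsSuccLimit (a' : Ordinal.{u}) := by
    by_contra h
    simp [hempty a' h] at hA'
  have hAc := hcof a ha hl A hA
  have hA'c := hcof a' ha' hl' A' hA'
  refine ordSup_inter_lt hl hAc ?_
  -- The claim is asymmetric, as the bound must lie below `a`. If `a' < a`, the level `a'` itself
  -- serves.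
  rcases lt_trichotomy a a' with h | rfl | h
  · rcases hlad a ha hl A hA with h1 | h1 <;> rcases hlad a' ha' hl' A' hA' with h2 | h2
    · exact exists_lt_of_mk_inter_lt ha hAc (h1.mk_inter_lt h h2)
    · exact exists_lt_of_mk_inter_lt ha hAc (h1.mk_inter_lt_of_isBranchLadder h2)
    · refine exists_lt_of_mk_inter_lt ha hAc ?_
      rw [inter_comm]
      exact h2.mk_inter_lt_of_isBranchLadder h1
    · exact h1.exists_inter_lt hbased hl ha h h2
  · have : A ∩ A' = ∅ := disjoint_iff_inter_eq_empty.1 (hdisj a ha hl hA hA' hAA')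
    obtain ⟨b, hb⟩ := exists_toOrd_eq ((hl.bot_lt).trans (toOrd_lt_ord a))
    refine ⟨b, toOrd_lt_toOrd.1 (hb ▸ hl.bot_lt), by simp [this]⟩
  · exact ⟨a', h, fun x hx => hA'c.1 x hx.2⟩

end SouslinTree

/-! ### Density, normality and counting small sets -/

namespace SouslinTree

variable {κ χ θ : Cardinal.{u}} {𝒯 : SouslinTree κ κ.ord.ToType}

theorem exists_forall_lt_of_mk_lt (hκ : κ.IsRegular) {s : Set κ.ord.ToType} (hs : #s < κ) :
    ∃ c, ∀ x ∈ s, x < c :=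
  exists_forall_lt_of_mk_lt_cof (by rwa [cof_toType, hκ.cof_ord])

theorem exists_gt_of_mk_eq {B : Set κ.ord.ToType} (hκ : ℵ₀ ≤ κ) (hB : #B = κ)
    (c : κ.ord.ToType) : ∃ z ∈ B, c < z := by
  by_contra! h
  exact ((mk_le_mk_of_subset (t := Iic c) h).trans_lt (mk_Iic_toType_lt hκ c)).ne hB

/-- A set of nodes of full size is dense above some node. -/
theorem exists_denseAbove (hκ : κ.IsRegular) (hbased : 𝒯.IsOrdinalBased)
    {B : Set κ.ord.ToType} (hB : #B = κ) : ∃ x, 𝒯.DenseAbove B x := by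
  -- The minimal nodes without extensions in `B` form an antichain, hence are bounded. An element
  -- `x` of `B` past the bound works: a bad node above `x` would put one of these minimal nodes
  -- below `x`.
  let U : Set κ.ord.ToType := {y | ∀ z ∈ B, ¬ 𝒯.le y z}
  obtain ⟨c, hc⟩ := exists_forall_lt_of_mk_lt hκ
    (𝒯.mk_lt_of_isAntichain (𝒯.isAntichain_minimals U))
  obtain ⟨x, hxB, hcx⟩ := exists_gt_of_mk_eq hκ.aleph0_le hB c
  refine ⟨x, fun y hxy => ?_⟩
  by_contra! hy
  obtain ⟨m, hm, hmy⟩ := 𝒯.exists_minimals_le (X := U) hy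
  have hmx : m < x := (hc m hm).trans hcx
  exact hm.1 x hxB (hmy.le_of_height_le hxy (hbased.height_mono hmx.le))

/-- The minimal elements of `B` that lie above `x` and past `d` form an antichain, hence are bounded
by some `c`. A node `w` past `c` has an extension in `B`, and a minimal element below that extension
already lies below `w`. -/
theorem DenseAbove.exists_le (hκ : κ.IsRegular) (hbased : 𝒯.IsOrdinalBased)
    {B : Set κ.ord.ToType} {x : κ.ord.ToType} (h : 𝒯.DenseAbove B x) (d : κ.ord.ToType) :
    ∃ c, ∀ w, 𝒯.le x w → c < w → ∃ z ∈ B, d < z ∧ 𝒯.le x z ∧ 𝒯.le z w := by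
  let X : Set κ.ord.ToType := {z | z ∈ B ∧ d < z ∧ 𝒯.le x z}
  obtain ⟨c, hc⟩ := exists_forall_lt_of_mk_lt hκ
    (𝒯.mk_lt_of_isAntichain (𝒯.isAntichain_minimals X))
  refine ⟨max c d, fun w hxw hw => ?_⟩
  obtain ⟨z, hzB, hwz⟩ := h w hxw
  have hz : z ∈ X := ⟨hzB, ((le_max_right _ _).trans_lt hw).trans_le (hbased.le_of_le hwz),
    hxw.trans hwz⟩
  obtain ⟨m, hm, hmz⟩ := 𝒯.exists_minimals_le hz
  have hmw : m < w := (hc m hm).trans ((le_max_left _ _).trans_lt hw)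
  exact ⟨m, hm.1.1, hm.1.2.1, hm.1.2.2, hmz.le_of_height_le hwz (hbased.height_mono hmw.le)⟩

/-- Branches through a node above which `B` is dense meet `B` cofinally, for club many
lengths. -/
theorem DenseAbove.exists_isClub (hκ : κ.IsRegular) (hκ_unc : ℵ₀ < κ)
    (hbased : 𝒯.IsOrdinalBased) {B : Set κ.ord.ToType} {x : κ.ord.ToType}
    (h : 𝒯.DenseAbove B x) : ∃ E : Set κ.ord.ToType, IsClub E ∧ ∀ a ∈ E,
      IsSuccLimit (a : Ordinal.{u}) → (∀ z, 𝒯.height z < (a : Ordinal.{u}) ↔ z < a) →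
      ∀ b, 𝒯.IsBranch (a : Ordinal.{u}) b → x ∈ b →
        IsCofinalSubset ({z ∈ b | 𝒯.le x z} ∩ B) a := by
  choose g hg using h.exists_le hκ hbased
  refine ⟨_, isClub_closurePoints (by rwa [cof_toType, hκ.cof_ord])
    (fun a => by rw [cof_toType, hκ.cof_ord]; exact mk_Iic_toType_lt hκ.aleph0_le a) g, ?_⟩
  intro a ha hl hht b hb hxb
  refine ⟨fun z hz => (hht z).1 (hb.height_lt hz.1.1), fun d hd => ?_⟩
  have hmax : max (𝒯.height (g d)) (𝒯.height x) < (a : Ordinal.{u}) :=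
    max_lt ((hht _).2 (ha d hd)) (hb.height_lt hxb)
  -- A strictly larger height makes `w` exceed `g d` as an ordinal.
  obtain ⟨w, hw, hwo⟩ := hb.exists_height_eq (hl.succ_lt hmax)
  have hlt : max (𝒯.height (g d)) (𝒯.height x) < 𝒯.height w := hwo ▸ lt_succ _
  obtain ⟨z, hzB, hdz, hxz, hzw⟩ := hg d w
    (hb.le_of_height_le hxb hw ((le_max_right _ _).trans hlt.le))
    (hbased _ _ ((le_max_left _ _).trans_lt hlt))
  exact ⟨z, ⟨⟨hb.mem_of_le hw hzw, hxz⟩, hzB⟩, hdz.le⟩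

/-- A tail of a branch is cofinal. -/
theorem IsBranch.isCofinalSubset (hbased : 𝒯.IsOrdinalBased) {a : κ.ord.ToType}
    (hl : IsSuccLimit (a : Ordinal.{u})) (hht : ∀ z, 𝒯.height z < (a : Ordinal.{u}) ↔ z < a)
    {b : Set κ.ord.ToType} (hb : 𝒯.IsBranch (a : Ordinal.{u}) b) {x : κ.ord.ToType}
    (hx : x ∈ b) : IsCofinalSubset {z ∈ b | 𝒯.le x z} a := by
  refine ⟨fun z hz => (hht z).1 (hb.height_lt hz.1), fun d hd => ?_⟩
  have hmax : max (𝒯.height d) (𝒯.height x) < (a : Ordinal.{u}) :=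
    max_lt ((hht _).2 hd) (hb.height_lt hx)
  obtain ⟨w, hw, hwo⟩ := hb.exists_height_eq (hl.succ_lt hmax)
  have hlt : max (𝒯.height d) (𝒯.height x) < 𝒯.height w := hwo ▸ lt_succ _
  exact ⟨w, ⟨hw, hb.le_of_height_le hx hw ((le_max_right _ _).trans hlt.le)⟩,
    (hbased _ _ ((le_max_left _ _).trans_lt hlt)).le⟩

variable (𝒯) in
/-- Every node has extensions of all heights below `κ`. -/
def IsNormal : Prop := ∀ (x : κ.ord.ToType) (o : Ordinal.{u}), 𝒯.height x ≤ o → o < κ.ord →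
  ∃ y, 𝒯.le x y ∧ 𝒯.height y = o

theorem isNormal_of_isStationary (hκ : κ.IsRegular) {S : Set κ.ord.ToType} (hS : IsStationary S)
    (hSV : S ⊆ 𝒯.vanishingLevels) : 𝒯.IsNormal := by
  intro x o hxo ho
  obtain ⟨c, hc⟩ := exists_toOrd_eq ho
  have := Cardinal.noMaxOrder hκ.aleph0_le
  obtain ⟨a, haS, hca⟩ := hS (isClub_Ioi c)
  have hoa : o < (a : Ordinal.{u}) := hc ▸ toOrd_lt_toOrd.2 hca
  obtain ⟨b, hb, -, hxb⟩ := (hSV haS).2 x (hxo.trans_lt hoa)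
  obtain ⟨y, hy, hyo⟩ := hb.exists_height_eq hoa
  exact ⟨y, hb.le_of_height_le hxb hy (hyo ▸ hxo), hyo⟩

/-- The club consists of the points closed under both `z ↦ height z` and a choice of a node of
height greater than `c`, which normality supplies. -/
theorem IsNormal.exists_isClub (hκ : κ.IsRegular) (hκ_unc : ℵ₀ < κ) (hbased : 𝒯.IsOrdinalBased)
    (hN : 𝒯.IsNormal) : ∃ D : Set κ.ord.ToType, IsClub D ∧
      ∀ a ∈ D, ∀ z, 𝒯.height z < (a : Ordinal.{u}) ↔ z < a := by
  have hcof : ℵ₀ < Order.cof κ.ord.ToType := by rwa [cof_toType, hκ.cof_ord]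
  have hseg : ∀ a : κ.ord.ToType, #(Iic a) < Order.cof κ.ord.ToType := fun a => by
    rw [cof_toType, hκ.cof_ord]
    exact mk_Iic_toType_lt hκ.aleph0_le a
  choose h hh using fun z => exists_toOrd_eq (hbased.height_lt_ord z)
  have hup : ∀ c : κ.ord.ToType, ∃ y, (c : Ordinal.{u}) < 𝒯.height y := fun c => by
    have hlim := isSuccLimit_ord hκ.aleph0_le
    obtain ⟨y, -, hy⟩ := hN c (succ (max (c : Ordinal.{u}) (𝒯.height c)))
      ((le_max_right _ _).trans (le_succ _))
      (hlim.succ_lt (max_lt (toOrd_lt_ord c) (hbased.height_lt_ord c)))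
    exact ⟨y, hy ▸ lt_succ_of_le (le_max_left _ _)⟩
  choose g hg using hup
  refine ⟨_, (isClub_closurePoints hcof hseg h).inter hcof.ne' (isClub_closurePoints hcof hseg g),
    fun a ha z => ⟨fun hz => ?_, fun hz => ?_⟩⟩
  · rw [← hh z, toOrd_lt_toOrd] at hz
    exact (hbased _ _ ((hh z).symm.trans_lt (hg (h z)))).trans (ha.2 _ hz)
  · rw [← hh z, toOrd_lt_toOrd]
    exact ha.1 z hz

/-- Above every node there are antichains of all sizes below `κ`. -/
theorem IsNormal.exists_antichain (hκ : κ.IsRegular) (hbased : 𝒯.IsOrdinalBased)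
    (hN : 𝒯.IsNormal) (hsplit : 𝒯.IsSplitting χ) (hχ : ℵ₀ ≤ χ) (x m : κ.ord.ToType) :
    ∃ q : Iio m → κ.ord.ToType, (∀ i, 𝒯.le x (q i)) ∧
      ∀ i j z, 𝒯.le (q i) z → 𝒯.le (q j) z → i = j := by
  -- The nodes `q i` form a comb along the path from `x` to `y`. For `i < j`, a common extension of
  -- `q i` and `q j` would put `q i` below `p j`, hence on the path.
  obtain ⟨y, hxy, hy⟩ := hN x (𝒯.height x + (m : Ordinal.{u})) le_self_add
    (isPrincipal_add_ord hκ.aleph0_le (hbased.height_lt_ord x) (toOrd_lt_ord m))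
  have hex : ∀ i : Iio m, ∃ q p, 𝒯.lt p y ∧ 𝒯.lt p q ∧ 𝒯.le x p ∧
      𝒯.height p = 𝒯.height x + ((i : κ.ord.ToType) : Ordinal.{u}) ∧
      𝒯.height q = 𝒯.height p + 1 ∧ ¬ 𝒯.le q y := fun i => by
    obtain ⟨p, hpy, hp⟩ := 𝒯.exists_lt_height_eq
      (y := y) (o := 𝒯.height x + ((i : κ.ord.ToType) : Ordinal.{u})) (by
        rw [hy]
        exact (add_lt_add_iff_left _).2 (toOrd_lt_toOrd.2 i.2))
    obtain ⟨q, hpq, hq, hqy⟩ := hsplit.exists_succ_not_le hχ p y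
    exact ⟨q, p, hpy, hpq, hxy.le_of_height_le (Or.inr hpy) (hp ▸ le_self_add), hp, hq, hqy⟩
  choose q p hpy hpq hxp hp hq hqy using hex
  have key : ∀ i j, i < j → ∀ z, 𝒯.le (q i) z → ¬ 𝒯.le (q j) z := by
    intro i j hij z hi hj
    refine hqy i (Or.inr (le.trans_lt (le.le_of_height_le hi
      (le.trans (Or.inr (hpq j)) hj) ?_) (hpy j)))
    rw [hq, hp, hp]
    exact add_one_le_of_lt ((add_lt_add_iff_left _).2 (toOrd_lt_toOrd.2 hij))
  refine ⟨q, fun i => (hxp i).trans (Or.inr (hpq i)), fun i j z hi hj => ?_⟩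
  rcases lt_trichotomy i j with h | h | h
  · exact absurd hj (key i j h z hi)
  · exact h
  · exact absurd hi (key j i h z hj)

theorem mk_small_sets_le (hκ : ℵ₀ ≤ κ) (hθκ : θ ≤ κ) (hθ : κ ^< θ = κ) :
    #{s : Set κ.ord.ToType // #s < θ} ≤ κ := by
  -- Sets are sorted by cardinality: each of the `θ ≤ κ` classes has at most `κ ^< θ = κ` members.
  have hsub : {s : Set κ.ord.ToType | #s < θ} ⊆
      ⋃ i : θ.ord.ToType, {s : Set κ.ord.ToType | #s ≤ #(Iio i)} := by
    intro s hs
    obtain ⟨i, hi⟩ := exists_toOrd_eq (κ := θ) (ord_lt_ord.2 hs)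
    refine mem_iUnion.2 ⟨i, ?_⟩
    change #s ≤ #(Iio i)
    rw [mk_Iio_toType, hi, card_ord]
  refine (mk_le_mk_of_subset hsub).trans ((mk_iUnion_le_sum_mk).trans ?_)
  refine (sum_le_sum _ (fun _ => κ) fun i => ?_).trans ?_
  · change #{s : Set κ.ord.ToType // #s ≤ #(Iio i)} ≤ κ
    refine (mk_bounded_set_le _ _).trans ?_
    rw [mk_ord_toType, max_eq_left hκ]
    exact (le_powerlt κ (mk_Iio_toType_lt i)).trans_eq hθ
  · rw [sum_const', mk_ord_toType]
    exact (mul_le_mul_left hθκ κ).trans_eq (mul_eq_self hκ)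

end SouslinTree

/-! ### Node families, coding and assembly of the system -/

namespace SouslinTree

variable {κ χ θ : Cardinal.{u}} {𝒯 : SouslinTree κ κ.ord.ToType}

variable (𝒯 χ) in
/-- A nonempty family of small nonempty sets of nodes, nodes of different sets being
incompatible. -/
structure IsNodeFamily (N : Set (Set κ.ord.ToType)) : Prop where
  nonempty : N.Nonempty
  nonempty_of_mem : ∀ n ∈ N, n.Nonempty
  mk_lt : ∀ n ∈ N, #n < χ
  eq_of_le : ∀ n ∈ N, ∀ n' ∈ N, ∀ y ∈ n, ∀ y' ∈ n', ∀ z, 𝒯.le y z → 𝒯.le y' z → n = n'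

/-- There are `κ` many families of sets of nodes such that any few sets of full size are dense
above some node of each member of one of the families. -/
theorem IsNormal.exists_nodeFamilies (hκ : κ.IsRegular) (hbased : 𝒯.IsOrdinalBased)
    (hN : 𝒯.IsNormal) (hsplit : 𝒯.IsSplitting χ) (hχ : ℵ₀ ≤ χ) (hχκ : χ < κ) (hθχ : θ ≤ χ)
    (hθ : κ ^< θ = κ) :
    ∃ (P : Type u) (N : P → Set (Set κ.ord.ToType)), Nonempty P ∧ #P ≤ κ ∧
      ∀ 𝓑 : Set (Set κ.ord.ToType), (∀ B ∈ 𝓑, #B = κ) → #𝓑 < θ → ∀ μ < κ, ∃ p,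
        𝒯.IsNodeFamily χ (N p) ∧ μ ≤ #(N p) ∧ (∃ c, ∀ n ∈ N p, ∀ y ∈ n, y < c) ∧
        ∀ n ∈ N p, ∀ B ∈ 𝓑, ∃ y ∈ n, 𝒯.DenseAbove B y := by
  have h1θ : 1 < θ := by
    by_contra! h
    have : κ ≤ 1 := by
      rw [← hθ, powerlt_le]
      intro c hc
      rw [Cardinal.lt_one_iff.1 (hc.trans_le h), power_zero]
    exact (one_lt_aleph0.trans_le hκ.aleph0_le).not_ge this
  choose q hxq hq using hN.exists_antichain hκ hbased hsplit hχ
  have hne : Nonempty κ.ord.ToType :=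
    mk_ne_zero_iff.1 (by rw [mk_ord_toType]; exact hκ.ne_zero)
  refine ⟨{s : Set κ.ord.ToType // #s < θ} × κ.ord.ToType,
    fun p => range fun i : Iio p.2 => (q · p.2 i) '' p.1.1, ?_, ?_, ?_⟩
  · exact ⟨⟨⟨∅, by simpa using zero_lt_one.trans h1θ⟩, hne.some⟩⟩
  · rw [mk_prod, Cardinal.lift_id, Cardinal.lift_id, mk_ord_toType]
    exact (mul_le_mul_left (mk_small_sets_le hκ.aleph0_le (hθχ.trans hχκ.le) hθ) κ).trans_eq
      (mul_eq_self hκ.aleph0_le)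
  intro 𝓑₀ h𝓑₀ h𝓑₀θ μ hμ
  -- An empty family is replaced by `{univ}`, so that the node sets are nonempty and thus distinct
  -- for distinct indices.
  obtain ⟨𝓑, h𝓑sub, h𝓑, h𝓑θ, h𝓑ne⟩ : ∃ 𝓑 : Set (Set κ.ord.ToType), 𝓑₀ ⊆ 𝓑 ∧
      (∀ B ∈ 𝓑, #B = κ) ∧ #𝓑 < θ ∧ 𝓑.Nonempty := by
    rcases 𝓑₀.eq_empty_or_nonempty with rfl | h
    · exact ⟨{Set.univ}, empty_subset _, by simp, by simpa using h1θ, singleton_nonempty _⟩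
    · exact ⟨𝓑₀, Subset.rfl, h𝓑₀, h𝓑₀θ, h⟩
  choose x hx using fun B : 𝓑 => exists_denseAbove hκ hbased (h𝓑 B B.2)
  have h𝓑κ : #𝓑 < κ := h𝓑θ.trans_le (hθχ.trans hχκ.le)
  obtain ⟨c, hc⟩ := exists_forall_lt_of_mk_lt hκ (s := range x) (mk_range_le.trans_lt h𝓑κ)
  -- At a common height, distinct nodes are incompatible. Hence nodes `q i`, `q j` above `e B`, `e
  -- B'` with a common extension force `e B = e B'`, and then `i = j`.
  choose e hxe he using fun B : 𝓑 => hN (x B) (𝒯.height c)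
    (hbased.height_mono (hc _ ⟨B, rfl⟩).le) (hbased.height_lt_ord c)
  -- Taking `max μ 1` keeps the family nonempty when `μ = 0`.
  obtain ⟨m, hm⟩ := exists_toOrd_eq (κ := κ)
    (ord_lt_ord.2 (max_lt hμ (one_lt_aleph0.trans_le hκ.aleph0_le)))
  have hmk : #(Iio m) = max μ 1 := by rw [mk_Iio_toType, hm, card_ord]
  have hmne : Nonempty (Iio m) := mk_ne_zero_iff.1 (by
    rw [hmk]
    exact (zero_lt_one.trans_le (le_max_right μ 1)).ne')
  have hrange : (range e).Nonempty := by
    obtain ⟨B, hB⟩ := h𝓑ne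
    exact ⟨_, ⟨B, hB⟩, rfl⟩
  have heq : ∀ i j : Iio m, ∀ y ∈ (q · m i) '' range e, ∀ y' ∈ (q · m j) '' range e, ∀ z,
      𝒯.le y z → 𝒯.le y' z → i = j := by
    rintro i j _ ⟨_, ⟨B, rfl⟩, rfl⟩ _ ⟨_, ⟨B', rfl⟩, rfl⟩ z hz hz'
    have : e B = e B' := ((hxq _ m i).trans hz).eq_of_height_eq ((hxq _ m j).trans hz')
      ((he B).trans (he B').symm)
    simp only [this] at hz
    exact hq _ m i j z hz hz'
  refine ⟨⟨⟨range e, mk_range_le.trans_lt h𝓑θ⟩, m⟩, ⟨range_nonempty _, ?_, ?_, ?_⟩, ?_, ?_, ?_⟩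
  · rintro _ ⟨i, rfl⟩
    exact hrange.image _
  · rintro _ ⟨i, rfl⟩
    exact (mk_image_le.trans mk_range_le).trans_lt (h𝓑θ.trans_le hθχ)
  · rintro _ ⟨i, rfl⟩ _ ⟨j, rfl⟩ y hy y' hy' z hz hz'
    rw [heq i j y hy y' hy' z hz hz']
  · rw [mk_range_eq]
    · exact hmk ▸ le_max_left _ _
    · intro i j hij
      obtain ⟨y, hy⟩ := hrange.image (q · m i)
      have hij' : (q · m i) '' range e = (q · m j) '' range e := hij
      exact heq i j y hy y (hij' ▸ hy) y (𝒯.le_refl y) (𝒯.le_refl y)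
  · obtain ⟨d, hd⟩ := exists_forall_lt_of_mk_lt hκ
      (s := range fun t : 𝓑 × Iio m => q (e t.1) m t.2) (by
        refine mk_range_le.trans_lt ?_
        rw [mk_prod, Cardinal.lift_id, Cardinal.lift_id]
        exact mul_lt_of_lt hκ.aleph0_le h𝓑κ (mk_Iio_toType_lt m))
    refine ⟨d, ?_⟩
    rintro _ ⟨i, rfl⟩ _ ⟨_, ⟨B, rfl⟩, rfl⟩
    exact hd _ ⟨(B, i), rfl⟩
  · rintro _ ⟨i, rfl⟩ B hB
    refine ⟨_, ⟨_, ⟨⟨B, h𝓑sub hB⟩, rfl⟩, rfl⟩, ?_⟩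
    exact ((hx ⟨B, h𝓑sub hB⟩).mono (hxe _)).mono (hxq _ m i)

/-- Branch ladders along the node families `M a` can be completed to an almost disjoint
system. -/
theorem exists_isADMultiLadderSystem (hbased : 𝒯.IsOrdinalBased) (hsplit : 𝒯.IsSplitting χ)
    (M : κ.ord.ToType → Set (Set κ.ord.ToType)) :
    ∃ 𝒜 : κ.ord.ToType → Set (Set κ.ord.ToType), IsADMultiLadderSystem (cofSet κ χ) 𝒜 ∧
      ∀ a ∈ 𝒯.vanishingLevels, (∀ z, 𝒯.height z < (a : Ordinal.{u}) ↔ z < a) →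
        𝒯.IsNodeFamily χ (M a) → (∀ n ∈ M a, ∀ y ∈ n, y < a) →
        #(M a) ≤ #(𝒜 a) ∧ ∀ A ∈ 𝒜 a, ∃ n ∈ M a, ∀ y ∈ n,
          ∃ b, 𝒯.IsBranch (a : Ordinal.{u}) b ∧ y ∈ b ∧ {z ∈ b | 𝒯.le y z} ⊆ A := by
  have key : ∀ a : κ.ord.ToType, ∃ F : Set (Set κ.ord.ToType),
      (¬ IsSuccLimit (a : Ordinal.{u}) → F = ∅) ∧
      (a ∈ cofSet κ χ → IsSuccLimit (a : Ordinal.{u}) → F.Nonempty ∧ F.PairwiseDisjoint id ∧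
        ∀ A ∈ F, 𝒯.IsAntichainLadder χ a A ∨ 𝒯.IsBranchLadder χ a A) ∧
      (a ∈ 𝒯.vanishingLevels → (∀ z, 𝒯.height z < (a : Ordinal.{u}) ↔ z < a) →
        𝒯.IsNodeFamily χ (M a) → (∀ n ∈ M a, ∀ y ∈ n, y < a) →
        #(M a) ≤ #F ∧ ∀ A ∈ F, ∃ n ∈ M a, ∀ y ∈ n,
          ∃ b, 𝒯.IsBranch (a : Ordinal.{u}) b ∧ y ∈ b ∧ {z ∈ b | 𝒯.le y z} ⊆ A) := by
    intro a
    by_cases hgood : a ∈ 𝒯.vanishingLevels ∧ (∀ z, 𝒯.height z < (a : Ordinal.{u}) ↔ z < a) ∧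
        𝒯.IsNodeFamily χ (M a) ∧ ∀ n ∈ M a, ∀ y ∈ n, y < a
    · obtain ⟨⟨hl, hV⟩, hht, hM, hlt⟩ := hgood
      have : Nonempty κ.ord.ToType := ⟨a⟩
      choose! br hbr hvan hmem using hV
      let ladder : Set κ.ord.ToType → Set κ.ord.ToType :=
        fun n => ⋃ y ∈ n, {z ∈ br y | 𝒯.le y z}
      have hlad : ∀ n ∈ M a, 𝒯.IsBranchLadder χ a (ladder n) := by
        intro n hn
        have hy : ∀ y ∈ n, 𝒯.height y < (a : Ordinal.{u}) := fun y hy => (hht y).2 (hlt n hn y hy)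
        have hcof : ∀ y ∈ n, IsCofinalSubset {z ∈ br y | 𝒯.le y z} a := fun y hyn =>
          (hbr y (hy y hyn)).isCofinalSubset hbased hl hht (hmem y (hy y hyn))
        refine ⟨⟨fun z hz => ?_, fun d hd => ?_⟩, hht, br '' n, mk_image_le.trans_lt (hM.mk_lt n hn),
          ?_, fun z hz => ?_⟩
        · obtain ⟨y, hyn, hz⟩ := mem_iUnion₂.1 hz
          exact (hcof y hyn).1 z hz
        · obtain ⟨y, hyn⟩ := hM.nonempty_of_mem n hn
          obtain ⟨z, hz, hdz⟩ := (hcof y hyn).2 d hd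
          exact ⟨z, mem_iUnion₂.2 ⟨y, hyn, hz⟩, hdz⟩
        · rintro _ ⟨y, hyn, rfl⟩
          exact ⟨hbr y (hy y hyn), hvan y (hy y hyn)⟩
        · obtain ⟨y, hyn, hz⟩ := mem_iUnion₂.1 hz
          exact ⟨br y, ⟨y, hyn, rfl⟩, hz.1⟩
      have hdisj : ∀ n ∈ M a, ∀ n' ∈ M a, n ≠ n' → Disjoint (ladder n) (ladder n') := by
        intro n hn n' hn' hne
        refine disjoint_left.2 fun z hz hz' => hne ?_
        obtain ⟨y, hyn, hz⟩ := mem_iUnion₂.1 hz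
        obtain ⟨y', hyn', hz'⟩ := mem_iUnion₂.1 hz'
        exact hM.eq_of_le n hn n' hn' y hyn y' hyn' z hz.2 hz'.2
      refine ⟨ladder '' M a, fun h => absurd hl h, fun _ _ => ⟨hM.nonempty.image _, ?_, ?_⟩,
        fun _ _ _ _ => ⟨?_, ?_⟩⟩
      · rintro _ ⟨n, hn, rfl⟩ _ ⟨n', hn', rfl⟩ hne
        exact hdisj n hn n' hn' fun h => hne (h ▸ rfl)
      · rintro _ ⟨n, hn, rfl⟩
        exact Or.inr (hlad n hn)
      · refine (mk_image_eq_of_injOn _ _ fun n hn n' hn' h => ?_).ge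
        by_contra hne
        obtain ⟨y, hyn⟩ := hM.nonempty_of_mem n hn
        have hyl : y ∈ ladder n := mem_iUnion₂.2 ⟨y, hyn,
          hmem y ((hht y).2 (hlt n hn y hyn)), 𝒯.le_refl y⟩
        exact disjoint_left.1 (hdisj n hn n' hn' hne) hyl (h ▸ hyl)
      · rintro _ ⟨n, hn, rfl⟩
        refine ⟨n, hn, fun y hyn => ?_⟩
        have hy := (hht y).2 (hlt n hn y hyn)
        exact ⟨br y, hbr y hy, hmem y hy, fun z hz => mem_iUnion₂.2 ⟨y, hyn, hz⟩⟩
    · by_cases ha : IsSuccLimit (a : Ordinal.{u}) ∧ a ∈ cofSet κ χ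
      · obtain ⟨A, hA⟩ := exists_isAntichainLadder hbased hsplit ha.1 ha.2
        refine ⟨{A}, fun h => absurd ha.1 h, fun _ _ => ⟨singleton_nonempty _,
          pairwiseDisjoint_singleton _ _, ?_⟩, fun h1 h2 h3 h4 => absurd ⟨h1, h2, h3, h4⟩ hgood⟩
        rintro _ rfl
        exact Or.inl hA
      -- The empty family at the remaining points keeps them from interfering with almost
      -- disjointness, which also quantifies over non-limit points of `cofSet κ χ`.
      · exact ⟨∅, fun _ => rfl, fun h1 h2 => absurd ⟨h2, h1⟩ ha,
          fun h1 h2 h3 h4 => absurd ⟨h1, h2, h3, h4⟩ hgood⟩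
  choose 𝒜 h1 h2 h3 using key
  exact ⟨𝒜, isADMultiLadderSystem hbased h1 (fun a ha hl => (h2 a ha hl).1)
    (fun a ha hl => (h2 a ha hl).2.1) (fun a ha hl => (h2 a ha hl).2.2), h3⟩

/-- Pairwise disjoint stationary sets of points of cofinality `χ < κ` can be simultaneously
partitioned into stationary sets indexed by a set of size at most `κ`. -/
theorem exists_forall_isStationary_fiber (hκ : κ.IsRegular) (hκ_unc : ℵ₀ < κ) (hχκ : χ < κ)
    {𝒮 : Set (Set κ.ord.ToType)} (hstat : ∀ S ∈ 𝒮, IsStationary S)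
    (hsub : ∀ S ∈ 𝒮, S ⊆ cofSet κ χ) (hdisj : ∀ S ∈ 𝒮, ∀ S' ∈ 𝒮, S ≠ S' → Disjoint S S')
    {P : Type u} [Nonempty P] (hP : #P ≤ κ) :
    ∃ f : κ.ord.ToType → P, ∀ S ∈ 𝒮, ∀ p, IsStationary {a ∈ S | f a = p} := by
  classical
  have hcof : Order.cof κ.ord.ToType = κ := by rw [cof_toType, hκ.cof_ord]
  have hne : Nonempty κ.ord.ToType :=
    mk_ne_zero_iff.1 (by rw [mk_ord_toType]; exact hκ.ne_zero)
  have hlad : ∀ a : κ.ord.ToType, a ∈ cofSet κ χ → ∃ l : χ.ord.ToType → κ.ord.ToType,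
      (∀ i, l i < a) ∧ ∀ b < a, ∃ i, b ≤ l i := by
    intro a ha
    obtain ⟨s, hs, hsc⟩ := exists_cof_eq (Iio a)
    rw [cof_Iio_toType, show (a : Ordinal.{u}).cof = χ from ha, ← mk_ord_toType χ] at hsc
    obtain ⟨e⟩ := Cardinal.eq.1 hsc
    refine ⟨fun i => ((e.symm i : Iio a) : κ.ord.ToType), fun i => (e.symm i : Iio a).2,
      fun b hb => ?_⟩
    obtain ⟨c, hc, hbc⟩ := hs ⟨b, hb⟩
    exact ⟨e ⟨c, hc⟩, by simpa using Subtype.coe_le_coe.2 hbc⟩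
  choose! lad hlt hlad using hlad
  have hS : ∀ S ∈ 𝒮, ∃ f : κ.ord.ToType → P, ∀ p, IsStationary {a ∈ S | f a = p} :=
    fun S hS => (hstat S hS).exists_forall_isStationary_fiber (by rwa [hcof])
      (fun a => by rw [hcof]; exact mk_Iic_toType_lt hκ.aleph0_le a)
      (by rw [hcof, mk_ord_toType]) (by rwa [hcof, mk_ord_toType]) lad
      (fun a ha => hlt a (hsub S hS ha)) (fun a ha => hlad a (hsub S hS ha))
      (by rwa [mk_ord_toType])
  choose! F hF using hS
  refine ⟨fun a => if h : ∃ S ∈ 𝒮, a ∈ S then F h.choose a else Classical.arbitrary P,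
    fun S hS p => (hF S hS p).mono fun a ha => ⟨ha.1, ?_⟩⟩
  have h : ∃ S ∈ 𝒮, a ∈ S := ⟨S, hS, ha.1⟩
  have hSe : h.choose = S := by
    by_contra hne
    exact disjoint_left.1 (hdisj _ h.choose_spec.1 S hS hne) h.choose_spec.2 ha.1
  change (if h : ∃ S ∈ 𝒮, a ∈ S then F h.choose a else Classical.arbitrary P) = p
  rw [dif_pos h, hSe]
  exact ha.2

end SouslinTree

/-! ### The main theorem -/

open SouslinTree in
theorem mainTheorem5 (κ χ θ : Cardinal.{u}) (hκ : κ.IsRegular) (hκ_unc : ℵ₀ < κ)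
    (𝒯 : SouslinTree κ κ.ord.ToType) (hbased : 𝒯.IsOrdinalBased) (hsplit : 𝒯.IsSplitting χ)
    (hθχ : θ ≤ χ) (hθ : κ ^< θ = κ)
    (𝒮 : Set (Set κ.ord.ToType))
    (h𝒮_stat : ∀ S ∈ 𝒮, IsStationary S)
    (h𝒮_sub : ∀ S ∈ 𝒮, S ⊆ 𝒯.vanishingLevels ∩ cofSet κ χ)
    (h𝒮_disj : ∀ S ∈ 𝒮, ∀ S' ∈ 𝒮, S ≠ S' → Disjoint S S') :
    ∃ 𝒜 : κ.ord.ToType → Set (Set κ.ord.ToType),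
      IsADMultiLadderSystem (cofSet κ χ) 𝒜 ∧
      ∀ ℬ : Set (Set κ.ord.ToType), (∀ B ∈ ℬ, #B = κ) → #ℬ < θ →
        ∀ S ∈ 𝒮, ∀ μ : Cardinal.{u}, μ < κ → IsStationary (guessSet 𝒜 μ S ℬ) := by
  -- The bounds `ℵ₀ ≤ χ < κ` and normality are extracted from a member of `𝒮`, so the empty case is
  -- separate. There `∅` is never a node family, and antichain ladders suffice.
  rcases 𝒮.eq_empty_or_nonempty with rfl | ⟨S₀, hS₀⟩
  · obtain ⟨𝒜, hAD, -⟩ := exists_isADMultiLadderSystem hbased hsplit fun _ => ∅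
    exact ⟨𝒜, hAD, fun ℬ _ _ S hS => absurd hS (notMem_empty S)⟩
  have hcof : Order.cof κ.ord.ToType = κ := by rw [cof_toType, hκ.cof_ord]
  have hcof' : ℵ₀ < Order.cof κ.ord.ToType := by rwa [hcof]
  have hmax := Cardinal.noMaxOrder hκ.aleph0_le
  obtain ⟨a₀, ha₀⟩ := (h𝒮_stat S₀ hS₀).nonempty
  have ha₀χ : (a₀ : Ordinal.{u}).cof = χ := (h𝒮_sub S₀ hS₀ ha₀).2
  have hχ : ℵ₀ ≤ χ := ha₀χ ▸ (isRegular_cof (h𝒮_sub S₀ hS₀ ha₀).1.1).aleph0_le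
  have hχκ : χ < κ := ha₀χ ▸ (cof_le_card _).trans_lt (lt_ord.1 (toOrd_lt_ord a₀))
  have hN : 𝒯.IsNormal := isNormal_of_isStationary hκ (h𝒮_stat S₀ hS₀)
    fun a ha => (h𝒮_sub S₀ hS₀ ha).1
  obtain ⟨P, N, hPne, hP, hPN⟩ := hN.exists_nodeFamilies hκ hbased hsplit hχ hχκ hθχ hθ
  obtain ⟨f, hf⟩ := exists_forall_isStationary_fiber hκ hκ_unc hχκ h𝒮_stat
    (fun S hS a ha => (h𝒮_sub S hS ha).2) h𝒮_disj hP
  obtain ⟨𝒜, hAD, h𝒜⟩ := exists_isADMultiLadderSystem hbased hsplit fun a => N (f a)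
  refine ⟨𝒜, hAD, fun ℬ hℬ hℬθ S hS μ hμ => ?_⟩
  obtain ⟨p, hfam, hμp, ⟨c, hc⟩, hdense⟩ := hPN ℬ hℬ hℬθ μ hμ
  obtain ⟨D, hD, hDht⟩ := hN.exists_isClub hκ hκ_unc hbased
  -- All nodes below the bound `c` are treated at once: there are fewer than `κ` pairs, so their
  -- clubs intersect in a club.
  have hE : ∀ t : Iio c × ℬ, ∃ E : Set κ.ord.ToType, IsClub E ∧ (𝒯.DenseAbove t.2.1 t.1.1 →
      ∀ a ∈ E, IsSuccLimit (a : Ordinal.{u}) →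
        (∀ z, 𝒯.height z < (a : Ordinal.{u}) ↔ z < a) →
        ∀ b, 𝒯.IsBranch (a : Ordinal.{u}) b → t.1.1 ∈ b →
          IsCofinalSubset ({z ∈ b | 𝒯.le t.1.1 z} ∩ t.2.1) a) := fun t => by
    by_cases h : 𝒯.DenseAbove t.2.1 t.1.1
    · obtain ⟨E, hE, hE'⟩ := h.exists_isClub hκ hκ_unc hbased
      exact ⟨E, hE, fun _ => hE'⟩
    · exact ⟨Set.univ, .univ, fun h' => absurd h' h⟩
  choose E hE hE' using hE
  have hclub : IsClub (⋂ t, E t) := IsClub.iInter hcof'.ne' (by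
    rw [Cardinal.lift_id, Cardinal.lift_id, hcof, mk_prod, Cardinal.lift_id, Cardinal.lift_id]
    exact mul_lt_of_lt hκ.aleph0_le (mk_Iio_toType_lt c)
      (hℬθ.trans_le (hθχ.trans hχκ.le))) hE
  refine ((((hf S hS p).inter_isClub hcof' hD).inter_isClub hcof' (isClub_Ioi c)).inter_isClub
    hcof' hclub).mono ?_
  rintro a ⟨⟨⟨⟨haS, rfl⟩, haD⟩, hca⟩, haE⟩
  obtain ⟨haV, haχ⟩ := h𝒮_sub S hS haS
  obtain ⟨hle, hbr⟩ := h𝒜 a haV (hDht a haD) hfam fun n hn y hy => (hc n hn y hy).trans hca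
  refine ⟨haS, hμp.trans hle, fun A hA B hB => ?_⟩
  obtain ⟨n, hn, hnA⟩ := hbr A hA
  obtain ⟨y, hy, hyB⟩ := hdense n hn B hB
  obtain ⟨b, hb, hyb, hbA⟩ := hnA y hy
  have hcofi := hE' (⟨y, hc n hn y hy⟩, ⟨B, hB⟩) hyB a (mem_iInter.1 haE _) haV.1
    (hDht a haD) b hb hyb
  refine IsCofinalSubset.ordSup_eq haV.1 ⟨fun z hz => ?_, fun d hd => ?_⟩
  · exact (hAD.cofinal a haχ haV.1 A hA).1 z hz.1
  · obtain ⟨z, hz, hdz⟩ := hcofi.2 d hd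
    exact ⟨z, ⟨hbA hz.1, hz.2⟩, hdz⟩
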